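/- \textbf{Setting.} A probabilistic transition system specification (PTSS) $P=(\Sigma,A,R)$ in PGSOS format consists of a signature $\Sigma$, a set $A$ of actions and a set $R$ of rules $$\frac{\{x_i\xrightarrow{a_{i,k}}\mu_{i,k}\mid 1\le i\le n,\ k\in K_i\}\qquad\{x_i\not\xrightarrow{b_{i,j}}\ \mid 1\le i\le n,\ j\in L_i\}}{f(x_1,\dots,x_n)\xrightarrow{a}\theta}$$ with $f\in\Sigma$ of rank $n$, finite index sets $K_i,L_i$, pairwise distinct state variables $x_i$ and distribution variables $\mu_{i,k}$, and a distribution term $\theta$ over these variables (built from distribution variables, Dirac distributions $\delta(t)$ of state terms $t$, convex combinations, and operators of $\Sigma$ applied to distribution terms), such that for every operator $f$ and action $a$ there are only finitely many rules with an $a$-labelled conclusion for $f$. It induces a unique supported transition relation $t\xrightarrow{a}\pi$ between closed terms $t\in T(\Sigma)$ and (discrete) probability distributions $\pi$ on $T(\Sigma)$; here $f(\pi_1,\dots,\pi_n)$ is the image of the product distribution under $f$. Let $\mathrm{der}(t,a)=\{\pi\mid t\xrightarrow{a}\pi\}$. For $d\colon T(\Sigma)^2\to[0,1]$ let $\mathbf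 K(d)(\pi,\pi')=\min_\omega\sum_{t,t'}d(t,t')\,\omega(t,t')$ over all couplings $\omega$ of $\pi,\pi'$, and let $\mathbf H$ be the Hausdorff lifting (with $\inf\emptyset=1$, $\sup\emptyset=0$). For $\lambda\in(0,1]$, a $1$-bounded pseudometric $d$ on $T(\Sigma)$ is a \emph{$\lambda$-bisimulation metric} if, whenever $d(t,t')<1$ and $t\xrightarrow{a}\pi$, there is $t'\xrightarrow{a}\pi'$ with $\lambda\,\mathbf K(d)(\pi,\pi')\le d(t,t')$; the \emph{$\lambda$-bisimilarity metric} $\mathbf d$ is the smallest one. The \emph{up-to-$k$ $\lambda$-bisimilarity metric} is $\mathbf d_k=\mathbf B^k(\mathbf 0)$, where $\mathbf B(d)(t,t')=\sup_{a\in A}\mathbf H(\lambda\cdot\mathbf K(d))(\mathrm{der}(t,a),\mathrm{der}(t',a))$. An $n$-ary operator $f$ is \emph{uniformly continuous} w.r.t.\ $d$ if for all $\varepsilon>0$ there are $\delta_1,\dots,\delta_n>0$ such that, for all closed terms $s_i,t_i$, $d(s_i,t_i)<\delta_i$ for all $i$ implies $d(f(s_1,\dots,s_n),f(t_1,\dots,t_n))<\varepsilon$.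 It is \emph{$K$-Lipschitz continuous} w.r.t.\ $d$, for $K\in\mathbb R_{\ge0}$, if $d(f(s_1,\dots,s_n),f(t_1,\dots,t_n))\le K\sum_i d(s_i,t_i)$ for all closed terms $s_i,t_i$, and \emph{Lipschitz continuous} if it is so for some $K$. Fix a termination action $\surd$, forking actions $l,r$ and a split action $s$ in $A$. Let $P_{\mathsf{cp}}$ be the PTSS with the operators stop $0$, probabilistic prefix $a.\bigoplus_{i=1}^n[p_i]\_$ ($a\in A$, $n\ge1$, $p_i\in(0,1]$, $\sum_ip_i=1$), alternative composition $+$, synchronous parallel composition $\mid$ and copy $\mathsf{cp}$, and the rules $$\frac{}{a.\bigoplus_i[p_i]x_i\xrightarrow{a}\sum_ip_i\delta(x_i)}\qquad\frac{x\xrightarrow{a}\mu}{x+y\xrightarrow{a}\mu}\qquad\frac{y\xrightarrow{a}\nu}{x+y\xrightarrow{a}\nu}\qquad\frac{x\xrightarrow{a}\mu\quad y\xrightarrow{a}\nu}{x\mid y\xrightarrow{a}\mu\mid\nu}\ (a\ne\surd)\qquad\frac{x\xrightarrow{\surd}\mu\quad y\xrightarrow{\surd}\nu}{x\mid y\xrightarrow{\surd}\delta(0)}$$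 $$\frac{x\xrightarrow{a}\mu}{\mathsf{cp}(x)\xrightarrow{a}\mu}\ (a\notin\{l,r\})\qquad\frac{x\xrightarrow{l}\mu\quad x\xrightarrow{r}\nu}{\mathsf{cp}(x)\xrightarrow{s}\mathsf{cp}(\mu)\mid\mathsf{cp}(\nu)}.$$ \textbf{Theorem.} Let $P=(\Sigma,A,R)$ be any PTSS in PGSOS format that is a disjoint extension of $P_{\mathsf{cp}}$ (i.e.\ it contains the operators and rules of $P_{\mathsf{cp}}$ and no further rule for these operators). Then: \begin{enumerate} \item for every $\lambda\in(0,1)$, $\mathsf{cp}$ is uniformly continuous w.r.t.\ the $\lambda$-bisimilarity metric $\mathbf d$; \item for every $\lambda\in(0,1]$ and every $k\ge0$, $\mathsf{cp}$ is $2^k$-Lipschitz continuous w.r.t.\ the up-to-$k$ $\lambda$-bisimilarity metric $\mathbf d_k$; \item if $s\neq\surd$, then for every $\lambda\in(0,1]$, $\mathsf{cp}$ is not Lipschitz continuous w.r.t.\ the $\lambda$-bisimilarity metric $\mathbf d$. \end{enumerate} -/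

import Mathlib

open scoped NNReal ENNReal

universe u v w

namespace PGSOS

/-! ### Signatures and terms -/

/-- A signature: a type of operators with a rank function. -/
structure Signature where
  Op : Type u
  ar : Op → ℕ

/-- State terms over a signature with state variables in `V`. -/
inductive Term (S : Signature.{u}) (V : Type) : Type u where
  | var (x : V) : Term S V
  | app (f : S.Op) (ts : Fin (S.ar f) → Term S V) : Term S V

/-- Closed terms, i.e. processes. -/
abbrev Proc (S : Signature.{u}) : Type u := Term S Empty

def Term.subst {S : Signature.{u}} {V W : Type} (σ : V → Term S W) : Term S V → Term S W
  | .var x => σ x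
  | .app f ts => .app f (fun i => (ts i).subst σ)

/-- The product distribution of finitely many distributions. -/
noncomputable def prodPMF {α : Type u} : (n : ℕ) → (Fin n → PMF α) → PMF (Fin n → α)
  | 0, _ => PMF.pure Fin.elim0
  | n + 1, π => (π 0).bind fun x => (prodPMF n (fun i => π i.succ)).map (Fin.cons x)

theorem prodPMF_apply {α : Type u} (n : ℕ) (π : Fin n → PMF α) (x : Fin n → α) :
    prodPMF n π x = ∏ i, π i (x i) := by
  induction n with
  | zero => simp [prodPMF, PMF.pure_apply, Subsingleton.elim x Fin.elim0]
  | succ n ih =>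
    classical
    have key : ∀ y, ((prodPMF n fun i => π i.succ).map (@Fin.cons n (fun _ => α) y)) x =
        if y = x 0 then ∏ i : Fin n, π i.succ (x i.succ) else 0 := by
      intro y
      rw [PMF.map_apply]
      split_ifs with h
      · subst h
        rw [tsum_eq_single (Fin.tail x), if_pos (Fin.cons_self_tail x).symm, ih]
        · rfl
        · intro z hz
          rw [if_neg]
          intro hx
          exact hz (by rw [hx, Fin.tail_cons])
      · refine ENNReal.tsum_eq_zero.2 fun z => if_neg ?_
        intro hx
        exact h (by rw [hx]; simp)
    rw [prodPMF, PMF.bind_apply, Fin.prod_univ_succ, tsum_eq_single (x 0)]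
    · rw [key, if_pos rfl]
    · intro y hy
      rw [key, if_neg hy, mul_zero]

/-- Distribution terms with state variables in `V` and distribution variables in `D`: variables,
instantiable Dirac distributions, (finite or countable) convex combinations, and lifted operators.
A distribution on the index type `I` is a family of weights that sum up to `1`. -/
inductive DTerm (S : Signature.{u}) (V D : Type) : Type (max u 1) where
  | var (μ : D) : DTerm S V D
  | dirac (t : Term S V) : DTerm S V D
  | sum (I : Type) (p : PMF I) (θ : I → DTerm S V D) : DTerm S V D
  | app (f : S.Op) (θ : Fin (S.ar f) → DTerm S V D) : DTerm S V D

/-- The distribution over processes denoted by a distribution term under a closed substitution. -/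
noncomputable def DTerm.eval {S : Signature.{u}} {V D : Type} (σ : V → Proc S)
    (ρ : D → PMF (Proc S)) : DTerm S V D → PMF (Proc S)
  | .var μ => ρ μ
  | .dirac t => PMF.pure (t.subst σ)
  | .sum _ p θ => p.bind fun i => (θ i).eval σ ρ
  | .app f θ => (prodPMF (S.ar f) fun i => (θ i).eval σ ρ).map (Term.app f)

/-! ### PGSOS rules, transition system specifications, induced model -/

/-- A PGSOS rule for an operator of rank `n`, without the operator and the label of its conclusion.
The source variables are `x_i`, `i : Fin n`.  For `k : Fin numPos` there is a positive premise
`x_(posArg k) ⟶ μ_k` with label `posLabel k`, for `j : Fin numNeg` there is a negative premise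
saying that `x_(negArg j)` has no transition with label `negLabel j`; the target is a distribution term over the `x_i` and the `μ_k`. -/
structure Rule (S : Signature.{u}) (A : Type v) (n : ℕ) where
  numPos : ℕ
  posArg : Fin numPos → Fin n
  posLabel : Fin numPos → A
  numNeg : ℕ
  negArg : Fin numNeg → Fin n
  negLabel : Fin numNeg → A
  target : DTerm S (Fin n) (Fin numPos)

/-- A probabilistic transition system specification in PGSOS format. `rules f a` is the set of the
rules whose conclusion is an `a`-labelled transition of a term with head operator `f`. -/
structure PTSS (S : Signature.{u}) (A : Type v) where
  rules : (f : S.Op) → A → Set (Rule S A (S.ar f))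
  finite_rules : ∀ f a, (rules f a).Finite

/-- The instance of `r` given by the processes `ts` for the source variables allows to derive a
transition to `π` from the transition relation `M`. -/
def Rule.Derives {S : Signature.{u}} {A : Type v} {n : ℕ} (r : Rule S A n) (ts : Fin n → Proc S)
    (M : Fin n → A → PMF (Proc S) → Prop) (π : PMF (Proc S)) : Prop :=
  ∃ ρ : Fin r.numPos → PMF (Proc S),
    (∀ k, M (r.posArg k) (r.posLabel k) (ρ k)) ∧
    (∀ j, ∀ π', ¬ M (r.negArg j) (r.negLabel j) π') ∧
    π = r.target.eval ts ρ

/-- The transition relation of the induced (i.e. the unique supported) model of `P`: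
`P.step t a π` means `t ⟶[a] π`. -/
def PTSS.step {S : Signature.{u}} {A : Type v} (P : PTSS S A) :
    Proc S → A → PMF (Proc S) → Prop
  | .var x => x.elim
  | .app f ts => fun a π => ∃ r ∈ P.rules f a, r.Derives ts (fun i => P.step (ts i)) π

/-- A transition relation is a supported model of `P` if it consists of exactly the transitions
that are derivable from it by a rule of `P`. -/
def PTSS.IsSupportedModel {S : Signature.{u}} {A : Type v} (P : PTSS S A)
    (M : Proc S → A → PMF (Proc S) → Prop) : Prop :=
  ∀ (f : S.Op) (ts : Fin (S.ar f) → Proc S) (a : A) (π : PMF (Proc S)),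
    M (.app f ts) a π ↔ ∃ r ∈ P.rules f a, r.Derives ts (fun i => M (ts i)) π

theorem PTSS.isSupportedModel_iff {S : Signature.{u}} {A : Type v} (P : PTSS S A)
    (M : Proc S → A → PMF (Proc S) → Prop) : P.IsSupportedModel M ↔ M = P.step := by
  constructor
  · intro h
    funext t
    induction t with
    | var x => exact x.elim
    | app f ts ih =>
      funext a π
      have h1 := h f ts a π
      simp only [ih] at h1
      exact propext h1
  · rintro rfl f ts a π
    exact Iff.rfl

/-- The set of the `a`-derivatives of `t`. -/
def PTSS.der {S : Signature.{u}} {A : Type v} (P : PTSS S A) (t : Proc S) (a : A) :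
    Set (PMF (Proc S)) :=
  {π | P.step t a π}

/-! ### Disjoint extensions -/

/-- An inclusion of signatures: an injection of the operators that preserves the rank. -/
structure Signature.Embedding (S₁ : Signature.{u}) (S₂ : Signature.{v}) where
  toFun : S₁.Op → S₂.Op
  injective : Function.Injective toFun
  ar_eq : ∀ f, S₂.ar (toFun f) = S₁.ar f

def Term.map {S₁ : Signature.{u}} {S₂ : Signature.{v}} (e : S₁.Embedding S₂) {V W : Type}
    (g : V → W) : Term S₁ V → Term S₂ W
  | .var x => .var (g x)
  | .app f ts => .app (e.toFun f) (fun i => (ts (Fin.cast (e.ar_eq f) i)).map e g)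

def DTerm.map {S₁ : Signature.{u}} {S₂ : Signature.{v}} (e : S₁.Embedding S₂) {V W D : Type}
    (g : V → W) : DTerm S₁ V D → DTerm S₂ W D
  | .var μ => .var μ
  | .dirac t => .dirac (t.map e g)
  | .sum I p θ => .sum I p (fun i => (θ i).map e g)
  | .app f θ => .app (e.toFun f) (fun i => (θ (Fin.cast (e.ar_eq f) i)).map e g)

/-- A rule over `S₁` read as a rule over `S₂`. -/
def Rule.map {S₁ : Signature.{u}} {S₂ : Signature.{v}} (e : S₁.Embedding S₂) {A : Type w}
    {n m : ℕ} (h : n = m) (r : Rule S₁ A n) : Rule S₂ A m where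
  numPos := r.numPos
  posArg := fun k => Fin.cast h (r.posArg k)
  posLabel := r.posLabel
  numNeg := r.numNeg
  negArg := fun j => Fin.cast h (r.negArg j)
  negLabel := r.negLabel
  target := r.target.map e (Fin.cast h)

/-- `P₂` is a disjoint extension of `P₁`: it has all the operators and the rules of `P₁`, and no
new rule for an operator of `P₁`. -/
def IsDisjointExtension {S₁ : Signature.{u}} {S₂ : Signature.{v}} {A : Type w}
    (e : S₁.Embedding S₂) (P₁ : PTSS S₁ A) (P₂ : PTSS S₂ A) : Prop :=
  ∀ (f : S₁.Op) (a : A), P₂.rules (e.toFun f) a = Rule.map e (e.ar_eq f).symm '' P₁.rules f a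

/-! ### Bisimulation metrics

Distances are `ℝ≥0∞`-valued functions bounded by `1`. -/

/-- `1`-bounded pseudometrics. -/
structure IsPseudometric {X : Type u} (d : X → X → ℝ≥0∞) : Prop where
  le_one : ∀ x y, d x y ≤ 1
  refl : ∀ x, d x x = 0
  symm : ∀ x y, d x y = d y x
  triangle : ∀ x y z, d x z ≤ d x y + d y z

/-- `ω` is a matching (coupling) for `(π, π')`. -/
def IsMatching {X : Type u} (π π' : PMF X) (ω : PMF (X × X)) : Prop :=
  ω.map Prod.fst = π ∧ ω.map Prod.snd = π'

/-- The Kantorovich lifting. -/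
noncomputable def kantorovich {X : Type u} (d : X → X → ℝ≥0∞) (π π' : PMF X) : ℝ≥0∞ :=
  ⨅ (ω : PMF (X × X)) (_ : IsMatching π π' ω), ∑' x : X × X, d x.1 x.2 * ω x

/-- The Hausdorff lifting of a function bounded by `1`, with `inf ∅ = 1` and `sup ∅ = 0`. -/
noncomputable def hausdorff {Y : Type u} (d : Y → Y → ℝ≥0∞) (B C : Set Y) : ℝ≥0∞ :=
  max (⨆ y ∈ B, min 1 (⨅ z ∈ C, d y z)) (⨆ z ∈ C, min 1 (⨅ y ∈ B, d z y))

section Metric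

variable {S : Signature.{u}} {A : Type v} (P : PTSS S A) (lam : ℝ≥0)

/-- `lam`-bisimulation metrics on the induced model of `P`. -/
structure IsBisimulationMetric (d : Proc S → Proc S → ℝ≥0∞) : Prop where
  isPseudometric : IsPseudometric d
  transfer : ∀ t t', d t t' < 1 → ∀ a π, P.step t a π →
    ∃ π', P.step t' a π' ∧ lam * kantorovich d π π' ≤ d t t'

/-- The `lam`-bisimilarity metric: the infimum, in the pointwise order, of all
`lam`-bisimulation metrics. -/
noncomputable def bisimilarityMetric : Proc S → Proc S → ℝ≥0∞ :=
  sInf {d | IsBisimulationMetric P lam d}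

/-- The bisimulation metric functional. -/
noncomputable def bisimFunctional (d : Proc S → Proc S → ℝ≥0∞) : Proc S → Proc S → ℝ≥0∞ :=
  fun t t' => ⨆ a : A, hausdorff (fun π π' => lam * kantorovich d π π') (P.der t a) (P.der t' a)

/-- The up-to-`k` bisimilarity metric. -/
noncomputable def upToMetric (k : ℕ) : Proc S → Proc S → ℝ≥0∞ :=
  (bisimFunctional P lam)^[k] (fun _ _ => 0)

end Metric

/-! ### Continuity of operators -/

/-- The operator `f` is uniformly continuous w.r.t. `d`. -/
def IsUniformlyContinuous {S : Signature.{u}} (d : Proc S → Proc S → ℝ≥0∞) (f : S.Op) : Prop :=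
  ∀ ε : ℝ≥0∞, 0 < ε → ∃ δ : Fin (S.ar f) → ℝ≥0∞, (∀ i, 0 < δ i) ∧
    ∀ s t : Fin (S.ar f) → Proc S, (∀ i, d (s i) (t i) < δ i) →
      d (.app f s) (.app f t) < ε

/-- The operator `f` is `K`-Lipschitz continuous w.r.t. `d`. -/
def IsLipschitz {S : Signature.{u}} (d : Proc S → Proc S → ℝ≥0∞) (f : S.Op) (K : ℝ≥0) : Prop :=
  ∀ s t : Fin (S.ar f) → Proc S,
    d (.app f s) (.app f t) ≤ K * ∑ i, d (s i) (t i)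

/-! ### The copy operator -/

/-- The copy operator, the synchronous parallel composition it relies on, and the operators nil,
probabilistic prefix `a.([p₁]_ ⊕ … ⊕ [pₙ]_)` with positive weights, and alternative composition. -/
inductive CpOp (A : Type u) : Type u where
  | nil : CpOp A
  | pre (a : A) (n : ℕ) (p : PMF (Fin n)) (hp : ∀ i, p i ≠ 0) : CpOp A
  | alt : CpOp A
  | par : CpOp A
  | cp : CpOp A

def CpOp.ar {A : Type u} : CpOp A → ℕ
  | .nil => 0
  | .pre _ n _ _ => n
  | .alt => 2
  | .par => 2
  | .cp => 1

abbrev cpSignature (A : Type u) : Signature.{u} := ⟨CpOp A, CpOp.ar⟩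

section CpRules

variable {A : Type u}

/-- No premises; the target is `∑ i, p i • δ(x_i)`. -/
noncomputable def preRule (n : ℕ) (p : PMF (Fin n)) : Rule (cpSignature A) A n where
  numPos := 0
  posArg := Fin.elim0
  posLabel := Fin.elim0
  numNeg := 0
  negArg := Fin.elim0
  negLabel := Fin.elim0
  target := .sum (Fin n) p (fun i => .dirac (.var i))

/-- From `x_i ⟶[a] μ` infer a transition to `μ`. -/
def mimicRule {n : ℕ} (i : Fin n) (a : A) : Rule (cpSignature A) A n where
  numPos := 1
  posArg := fun _ => i
  posLabel := fun _ => a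
  numNeg := 0
  negArg := Fin.elim0
  negLabel := Fin.elim0
  target := .var 0

/-- From `x ⟶[a] μ` and `y ⟶[a] ν` infer a transition of `x | y` to `μ | ν`. -/
def syncRule (a : A) : Rule (cpSignature A) A 2 where
  numPos := 2
  posArg := ![0, 1]
  posLabel := fun _ => a
  numNeg := 0
  negArg := Fin.elim0
  negLabel := Fin.elim0
  target := .app CpOp.par (fun i : Fin 2 => .var i)

/-- From `x ⟶[√] μ` and `y ⟶[√] ν` infer a transition of `x | y` to `δ(0)`. -/
def terminateRule (tick : A) : Rule (cpSignature A) A 2 where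
  numPos := 2
  posArg := ![0, 1]
  posLabel := fun _ => tick
  numNeg := 0
  negArg := Fin.elim0
  negLabel := Fin.elim0
  target := .dirac (.app CpOp.nil (fun i : Fin 0 => i.elim0))

/-- From `x ⟶[l] μ` and `x ⟶[r] ν` infer a transition of `cp(x)` to `cp(μ) | cp(ν)`. -/
def forkRule (l r : A) : Rule (cpSignature A) A 1 where
  numPos := 2
  posArg := fun _ => 0
  posLabel := ![l, r]
  numNeg := 0
  negArg := Fin.elim0
  negLabel := Fin.elim0
  target := .app CpOp.par (fun i : Fin 2 => .app CpOp.cp (fun _ : Fin 1 => .var i))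

/-- The rules with successful termination action `tick`, left and right forking actions `l`, `r`,
and split action `s`. -/
def cpRules (tick l r s : A) : (f : CpOp A) → A → Set (Rule (cpSignature A) A f.ar)
  | .nil, _ => ∅
  | .pre b n p _, a => {ru | a = b ∧ ru = preRule n p}
  | .alt, a => {mimicRule (n := 2) 0 a, mimicRule (n := 2) 1 a}
  | .par, a => {ru | (a ≠ tick ∧ ru = syncRule a) ∨ (a = tick ∧ ru = terminateRule tick)}
  | .cp, a => {ru | (a ≠ l ∧ a ≠ r ∧ ru = mimicRule (n := 1) 0 a) ∨ (a = s ∧ ru = forkRule l r)}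

def cpSpec (tick l r s : A) : PTSS (cpSignature A) A where
  rules := cpRules tick l r s
  finite_rules := by
    intro f a
    cases f with
    | nil => exact Set.finite_empty
    | pre b n p hp => exact (Set.finite_singleton (preRule n p)).subset fun ru h => h.2
    | alt =>
      exact (Set.finite_singleton (mimicRule (n := 2) 1 a)).insert (mimicRule (n := 2) 0 a)
    | par =>
      refine ((Set.finite_singleton (terminateRule tick)).insert (syncRule a)).subset ?_
      rintro ru (h | h)
      · exact Or.inl h.2
      · exact Or.inr h.2
    | cp =>
      refine ((Set.finite_singleton (forkRule l r)).insert (mimicRule (n := 1) 0 a)).subset ?_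
      rintro ru (h | h)
      · exact Or.inl h.2.2
      · exact Or.inr h.2

end CpRules

end PGSOS

/-!
The bisimilarity metric `𝐝` is the least fixed point of `𝐁`, and as `𝐁` contracts by the factor
`λ`, it exceeds `𝐝ₖ` by at most `λ ^ k`.  Parallel composition is nonexpansive for every `𝐝ₖ`, and
a step of `cp x` runs two copies in parallel, so `cp` is `2 ^ k`-Lipschitz for `𝐝ₖ`; if `λ < 1`,
the error `λ ^ k` can be made arbitrarily small, whence uniform continuity for `𝐝`.

Against Lipschitz continuity for `𝐝`, take two processes that differ with probability `q` after one
fork, and put them below `n` further deterministic forks, each of which contracts their distance by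
`λ`: the result is at distance at most `λ ^ (n + 1) * q`.  Their copies evolve deterministically,
through `n` split steps that scale the distance back by `λ ^ n`, into `2 ^ n` parallel copies.
After one more split step all of the `2 ^ (n + 1)` copies must be able to split again, and the two
processes differ in this respect with probability `1 - (1 - q) ^ 2 ^ (n + 1)`, which for small `q`
is about `2 ^ (n + 1) * q` and so exceeds `K * q` as soon as `n` is large.
-/

namespace PGSOS

/-! ### Expectation, Kantorovich lifting and Hausdorff lifting -/

section Expect

variable {X : Type u} {Y : Type v} {Z : Type w}

/-- The expected value of `f` under `π`. -/
noncomputable def expect (π : PMF X) (f : X → ℝ≥0∞) : ℝ≥0∞ := ∑' x, f x * π x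

theorem expect_bind (π : PMF X) (q : X → PMF Y) (f : Y → ℝ≥0∞) :
    expect (π.bind q) f = expect π fun x => expect (q x) f := by
  simp only [expect, PMF.bind_apply, ← ENNReal.tsum_mul_left, ← ENNReal.tsum_mul_right]
  rw [ENNReal.tsum_comm]
  exact tsum_congr fun x => tsum_congr fun y => by ring

theorem expect_pure (x : X) (f : X → ℝ≥0∞) : expect (PMF.pure x) f = f x := by
  classical
  rw [expect, tsum_eq_single x fun y hy => by simp [PMF.pure_apply, hy], PMF.pure_apply_self,
    mul_one]

theorem expect_map (π : PMF X) (g : X → Y) (f : Y → ℝ≥0∞) :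
    expect (π.map g) f = expect π fun x => f (g x) := by
  simp only [← PMF.bind_pure_comp, expect_bind, Function.comp_apply, expect_pure]

theorem expect_mono (π : PMF X) {f g : X → ℝ≥0∞} (h : ∀ x, f x ≤ g x) :
    expect π f ≤ expect π g :=
  ENNReal.tsum_le_tsum fun x => mul_le_mul_left (h x) _

theorem expect_add (π : PMF X) (f g : X → ℝ≥0∞) :
    expect π (fun x => f x + g x) = expect π f + expect π g := by
  simp only [expect, add_mul, ENNReal.tsum_add]

theorem expect_const_mul (π : PMF X) (c : ℝ≥0∞) (f : X → ℝ≥0∞) :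
    expect π (fun x => c * f x) = c * expect π f := by
  simp only [expect, mul_assoc, ENNReal.tsum_mul_left]

theorem expect_mul_const (π : PMF X) (f : X → ℝ≥0∞) (c : ℝ≥0∞) :
    expect π (fun x => f x * c) = expect π f * c := by
  simp only [mul_comm _ c, expect_const_mul]

theorem expect_const (π : PMF X) (c : ℝ≥0∞) : expect π (fun _ => c) = c := by
  simp only [expect, ENNReal.tsum_mul_left, PMF.tsum_coe, mul_one]

/-- The image of the product distribution of `μ` and `ν` under `g`, i.e. the lifting of the binary
operation `g` to distributions. -/
noncomputable def map₂ (g : X → Y → Z) (μ : PMF X) (ν : PMF Y) : PMF Z :=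
  μ.bind fun x => ν.map (g x)

theorem expect_map₂ (g : X → Y → Z) (μ : PMF X) (ν : PMF Y) (f : Z → ℝ≥0∞) :
    expect (map₂ g μ ν) f = expect μ fun x => expect ν fun y => f (g x y) := by
  simp only [map₂, expect_bind, expect_map]

end Expect

section Kantorovich

variable {X : Type u} {Y : Type v} {Z : Type w} {d : X → X → ℝ≥0∞}

theorem IsMatching.kantorovich_le {π π' : PMF X} {ω : PMF (X × X)} (h : IsMatching π π' ω) :
    kantorovich d π π' ≤ expect ω fun q => d q.1 q.2 :=
  iInf₂_le ω h

theorem le_kantorovich {π π' : PMF X} {c : ℝ≥0∞}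
    (h : ∀ ω, IsMatching π π' ω → c ≤ expect ω fun q => d q.1 q.2) : c ≤ kantorovich d π π' :=
  le_iInf₂ h

theorem kantorovich_mono {d' : X → X → ℝ≥0∞} (h : ∀ x y, d x y ≤ d' x y) (π π' : PMF X) :
    kantorovich d π π' ≤ kantorovich d' π π' :=
  le_kantorovich fun _ hω => hω.kantorovich_le.trans (expect_mono _ fun _ => h _ _)

theorem kantorovich_le_add_const {d' : X → X → ℝ≥0∞} {c : ℝ≥0∞}
    (h : ∀ x y, d x y ≤ d' x y + c) (π π' : PMF X) :
    kantorovich d π π' ≤ kantorovich d' π π' + c := by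
  rw [← tsub_le_iff_right]
  refine le_kantorovich fun ω hω => tsub_le_iff_right.2 ?_
  calc kantorovich d π π' ≤ expect ω fun q => d' q.1 q.2 + c :=
        hω.kantorovich_le.trans (expect_mono _ fun _ => h _ _)
    _ = (expect ω fun q => d' q.1 q.2) + c := by rw [expect_add, expect_const]

theorem kantorovich_map_map_le_expect (d : X → X → ℝ≥0∞) (p : PMF Y) (f g : Y → X) :
    kantorovich d (p.map f) (p.map g) ≤ expect p fun i => d (f i) (g i) := by
  have h : IsMatching (p.map f) (p.map g) (p.map fun i => (f i, g i)) := by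
    constructor <;> rw [PMF.map_comp] <;> rfl
  exact h.kantorovich_le.trans_eq (expect_map _ _ _)

theorem kantorovich_self (h : ∀ x, d x x = 0) (π : PMF X) : kantorovich d π π = 0 := by
  simpa only [PMF.map_id, id, h, expect_const, nonpos_iff_eq_zero] using
    kantorovich_map_map_le_expect d π id id

theorem IsMatching.map {π π' : PMF X} {ω : PMF (X × X)} (f : X → Y) (h : IsMatching π π' ω) :
    IsMatching (π.map f) (π'.map f) (ω.map (Prod.map f f)) := by
  obtain ⟨rfl, rfl⟩ := h
  constructor <;> simp only [PMF.map_comp] <;> rfl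

theorem kantorovich_map_le {d' : Y → Y → ℝ≥0∞} {c : ℝ≥0∞} (hc₀ : c ≠ 0) (hc : c ≠ ∞) (f : X → Y)
    (h : ∀ x x', d' (f x) (f x') ≤ c * d x x') (π π' : PMF X) :
    kantorovich d' (π.map f) (π'.map f) ≤ c * kantorovich d π π' := by
  rw [mul_comm, ← ENNReal.div_le_iff hc₀ hc]
  refine le_kantorovich fun ω hω => ?_
  rw [ENNReal.div_le_iff hc₀ hc, mul_comm, ← expect_const_mul]
  refine (hω.map f).kantorovich_le.trans ?_
  rw [expect_map]
  exact expect_mono _ fun _ => h _ _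

theorem IsMatching.map₂ {μ μ' : PMF X} {ν ν' : PMF Y} {ω₁ : PMF (X × X)} {ω₂ : PMF (Y × Y)}
    (g : X → Y → Z) (h₁ : IsMatching μ μ' ω₁) (h₂ : IsMatching ν ν' ω₂) :
    IsMatching (map₂ g μ ν) (map₂ g μ' ν')
      (map₂ (fun q r => (g q.1 r.1, g q.2 r.2)) ω₁ ω₂) := by
  obtain ⟨rfl, rfl⟩ := h₁
  obtain ⟨rfl, rfl⟩ := h₂
  constructor <;> simp only [PGSOS.map₂, PMF.map_bind, PMF.bind_map, PMF.map_comp] <;> rfl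

theorem kantorovich_map₂_le {d₂ : Y → Y → ℝ≥0∞} {d' : Z → Z → ℝ≥0∞} (g : X → Y → Z)
    (h : ∀ x x' y y', d' (g x y) (g x' y') ≤ d x x' + d₂ y y') (μ μ' : PMF X) (ν ν' : PMF Y) :
    kantorovich d' (map₂ g μ ν) (map₂ g μ' ν') ≤ kantorovich d μ μ' + kantorovich d₂ ν ν' := by
  refine ENNReal.le_iInf₂_add_iInf₂ fun ω₁ h₁ ω₂ h₂ => (h₁.map₂ g h₂).kantorovich_le.trans ?_
  rw [expect_map₂]
  calc _ ≤ expect ω₁ fun q => expect ω₂ fun r => d q.1 q.2 + d₂ r.1 r.2 :=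
        expect_mono _ fun _ => expect_mono _ fun _ => h _ _ _ _
    _ = _ := by simp only [expect_add, expect_const]; rfl

theorem expect_le_expect_add_kantorovich {f : X → ℝ≥0∞} (h : ∀ x y, f x ≤ f y + d x y)
    (π π' : PMF X) : expect π f ≤ expect π' f + kantorovich d π π' := by
  rw [← tsub_le_iff_left]
  refine le_kantorovich fun ω hω => tsub_le_iff_left.2 ?_
  obtain ⟨rfl, rfl⟩ := hω
  simp only [expect_map, ← expect_add]
  exact expect_mono _ fun q => h q.1 q.2

theorem IsPseudometric.le_kantorovich_pure (hd : IsPseudometric d) (x y : X) :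
    d x y ≤ kantorovich d (PMF.pure x) (PMF.pure y) := by
  have h := expect_le_expect_add_kantorovich (f := fun z => d z y)
    (fun z z' => (hd.triangle z z' y).trans_eq (add_comm _ _)) (PMF.pure x) (PMF.pure y)
  simpa only [expect_pure, hd.refl, zero_add] using h

theorem exists_disintegration (ω : PMF (X × Y)) :
    ∃ κ : X → PMF Y, ω = (ω.map Prod.fst).bind fun x => (κ x).map (Prod.mk x) := by
  classical
  have marginal (x : X) : (ω.map Prod.fst) x = ∑' y, ω (x, y) := by
    rw [PMF.map_apply, ENNReal.tsum_prod', tsum_eq_single x fun x' hx' => by simp [hx'.symm]]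
    simp only [if_true]
  have marginal_ne_top (x : X) : ∑' y, ω (x, y) ≠ ∞ := marginal x ▸ PMF.apply_ne_top _ _
  let κ (x : X) : PMF Y := if h : ∑' y, ω (x, y) = 0 then ω.map Prod.snd else
    PMF.normalize (fun y => ω (x, y)) h (marginal_ne_top x)
  have marginal_mul_κ (x : X) (y : Y) : (ω.map Prod.fst) x * κ x y = ω (x, y) := by
    by_cases h : ∑' y, ω (x, y) = 0
    · rw [marginal, h, zero_mul, ENNReal.tsum_eq_zero.1 h y]
    · simp only [κ, dif_neg h, PMF.normalize_apply, marginal]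
      rw [mul_comm, mul_assoc, ENNReal.inv_mul_cancel h (marginal_ne_top x), mul_one]
  refine ⟨κ, PMF.ext fun ⟨x, y⟩ => ?_⟩
  rw [PMF.bind_apply, tsum_eq_single x, PMF.map_apply (Prod.mk x), tsum_eq_single y, if_pos rfl,
    marginal_mul_κ]
  · exact fun y' hy' => if_neg fun h => hy' (congrArg Prod.snd h).symm
  · intro x' hx'
    rw [PMF.map_apply (Prod.mk x'), ENNReal.tsum_eq_zero.2, mul_zero]
    exact fun y' => if_neg fun h => hx' (congrArg Prod.fst h).symm

theorem IsMatching.exists_glue {π₁ π₂ π₃ : PMF X} {ω₁ ω₂ : PMF (X × X)}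
    (h₁ : IsMatching π₁ π₂ ω₁) (h₂ : IsMatching π₂ π₃ ω₂) :
    ∃ τ : PMF (X × X × X), τ.map (fun q => (q.1, q.2.1)) = ω₁ ∧ τ.map Prod.snd = ω₂ := by
  obtain ⟨κ, hκ⟩ := exists_disintegration ω₂
  refine ⟨ω₁.bind fun q => (κ q.2).map fun z => (q.1, q.2, z), ?_, ?_⟩
  · simp only [PMF.map_bind, PMF.map_comp]
    exact (congrArg ω₁.bind (funext fun q => PMF.map_const (κ q.2) q)).trans (PMF.bind_pure ω₁)
  · conv_rhs => rw [hκ, h₂.1, ← h₁.2]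
    simp only [PMF.map_bind, PMF.bind_map, PMF.map_comp]
    rfl

theorem kantorovich_triangle (h : ∀ x y z, d x z ≤ d x y + d y z) (π₁ π₂ π₃ : PMF X) :
    kantorovich d π₁ π₃ ≤ kantorovich d π₁ π₂ + kantorovich d π₂ π₃ := by
  refine ENNReal.le_iInf₂_add_iInf₂ fun ω₁ h₁ ω₂ h₂ => ?_
  obtain ⟨τ, rfl, rfl⟩ := h₁.exists_glue h₂
  have hτ : IsMatching π₁ π₃ (τ.map fun q => (q.1, q.2.2)) := by
    constructor
    · rw [← h₁.1, PMF.map_comp, PMF.map_comp]; rfl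
    · rw [← h₂.2, PMF.map_comp, PMF.map_comp]; rfl
  refine hτ.kantorovich_le.trans ?_
  change _ ≤ expect _ _ + expect _ _
  simp only [expect_map, ← expect_add]
  exact expect_mono _ fun _ => h _ _ _

end Kantorovich

section Hausdorff

variable {Y : Type u} {d : Y → Y → ℝ≥0∞} {B C : Set Y} {c : ℝ≥0∞}

theorem hausdorff_comm : hausdorff d B C = hausdorff d C B :=
  max_comm _ _

theorem hausdorff_le_one : hausdorff d B C ≤ 1 :=
  max_le (iSup₂_le fun _ _ => min_le_left _ _) (iSup₂_le fun _ _ => min_le_left _ _)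

theorem biInf_le_iff_of_finite (hC : C.Finite) (hc : c < ∞) {f : Y → ℝ≥0∞} :
    ⨅ z ∈ C, f z ≤ c ↔ ∃ z ∈ C, f z ≤ c := by
  simpa only [Finset.inf_eq_iInf, hC.mem_toFinset] using Finset.inf_le_iff (s := hC.toFinset) hc

theorem hausdorff_le_iff (hB : B.Finite) (hC : C.Finite) (hc : c < 1) :
    hausdorff d B C ≤ c ↔ (∀ y ∈ B, ∃ z ∈ C, d y z ≤ c) ∧ ∀ z ∈ C, ∃ y ∈ B, d z y ≤ c := by
  have hc' : c < ∞ := hc.trans ENNReal.one_lt_top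
  simp only [hausdorff, max_le_iff, iSup₂_le_iff, min_le_iff, hc.not_ge, false_or,
    biInf_le_iff_of_finite hB hc', biInf_le_iff_of_finite hC hc']

end Hausdorff

/-! ### The bisimilarity metric as a least fixed point -/

section Bisimulation

variable {S : Signature.{u}} {A : Type v} {P : PTSS S A} {lam : ℝ≥0}
  {d d' : Proc S → Proc S → ℝ≥0∞} {c c' : ℝ≥0∞}

theorem PTSS.finite_der (P : PTSS S A) (t : Proc S) (a : A) : (P.der t a).Finite := by
  induction t generalizing a with
  | var x => exact x.elim
  | app f ts ih =>
    have der_subset : P.der (.app f ts) a ⊆ ⋃ r ∈ P.rules f a, (fun ρ => r.target.eval ts ρ) ''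
        Set.univ.pi fun k => P.der (ts (r.posArg k)) (r.posLabel k) := by
      rintro π ⟨r, hr, ρ, hpos, -, rfl⟩
      exact Set.mem_biUnion hr ⟨ρ, fun k _ => hpos k, rfl⟩
    exact ((P.finite_rules f a).biUnion fun r _ =>
      (Set.Finite.pi fun k => ih (r.posArg k) (r.posLabel k)).image _).subset der_subset

/-- Every transition of `t` is matched by an equally labelled transition of `t'` whose target is,
after discounting, at Kantorovich distance at most `c`: one half of the transfer condition. -/
def IsSimulated (P : PTSS S A) (lam : ℝ≥0) (d : Proc S → Proc S → ℝ≥0∞) (c : ℝ≥0∞)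
    (t t' : Proc S) : Prop :=
  ∀ a π, P.step t a π → ∃ π', P.step t' a π' ∧ lam * kantorovich d π π' ≤ c

theorem IsSimulated.mono {t t' : Proc S} (hd : ∀ x y, d x y ≤ d' x y)
    (h : IsSimulated P lam d' c t t') : IsSimulated P lam d c t t' := fun a π hπ =>
  let ⟨π', hπ', hle⟩ := h a π hπ
  ⟨π', hπ', (mul_le_mul_right (kantorovich_mono hd _ _) _).trans hle⟩

theorem IsSimulated.refl (hd : ∀ x, d x x = 0) (t : Proc S) : IsSimulated P lam d 0 t t :=
  fun _ π hπ => ⟨π, hπ, by rw [kantorovich_self hd, mul_zero]⟩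

theorem IsSimulated.trans (hd : ∀ x y z, d x z ≤ d x y + d y z) {x y z : Proc S}
    (hxy : IsSimulated P lam d c x y) (hyz : IsSimulated P lam d c' y z) :
    IsSimulated P lam d (c + c') x z := by
  intro a π hπ
  obtain ⟨π', hπ', h⟩ := hxy a π hπ
  obtain ⟨π'', hπ'', h'⟩ := hyz a π' hπ'
  refine ⟨π'', hπ'', (mul_le_mul_right (kantorovich_triangle hd π π' π'') _).trans ?_⟩
  rw [mul_add]
  exact add_le_add h h'

theorem bisimFunctional_comm (t t' : Proc S) :
    bisimFunctional P lam d t t' = bisimFunctional P lam d t' t :=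
  iSup_congr fun _ => hausdorff_comm

theorem bisimFunctional_le_one (t t' : Proc S) : bisimFunctional P lam d t t' ≤ 1 :=
  iSup_le fun _ => hausdorff_le_one

theorem bisimFunctional_le_iff {t t' : Proc S} (hc : c < 1) :
    bisimFunctional P lam d t t' ≤ c ↔ IsSimulated P lam d c t t' ∧ IsSimulated P lam d c t' t := by
  simp only [bisimFunctional, iSup_le_iff,
    hausdorff_le_iff (P.finite_der _ _) (P.finite_der _ _) hc, forall_and]
  rfl

theorem bisimFunctional_le {t t' : Proc S} (h : c < 1 → IsSimulated P lam d c t t')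
    (h' : c < 1 → IsSimulated P lam d c t' t) : bisimFunctional P lam d t t' ≤ c :=
  (lt_or_ge c 1).elim (fun hc => (bisimFunctional_le_iff hc).2 ⟨h hc, h' hc⟩)
    (bisimFunctional_le_one t t').trans

theorem isSimulated_of_bisimFunctional_lt_one {t t' : Proc S}
    (h : bisimFunctional P lam d t t' < 1) :
    IsSimulated P lam d (bisimFunctional P lam d t t') t t' :=
  ((bisimFunctional_le_iff h).1 le_rfl).1

theorem bisimFunctional_le_of_symm {b : Proc S → Proc S → ℝ≥0∞} (hb : ∀ t t', b t t' = b t' t)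
    (h : ∀ t t', b t t' < 1 → IsSimulated P lam d (b t t') t t') : bisimFunctional P lam d ≤ b := by
  refine fun t t' => bisimFunctional_le (h t t') ?_
  rw [hb t t']
  exact h t' t

theorem monotone_bisimFunctional : Monotone (bisimFunctional P lam) := fun _ _ h =>
  bisimFunctional_le_of_symm bisimFunctional_comm fun _ _ ht =>
    (isSimulated_of_bisimFunctional_lt_one ht).mono h

theorem bisimFunctional_le_add_const (h : ∀ t t', d t t' ≤ d' t t' + c) (t t' : Proc S) :
    bisimFunctional P lam d t t' ≤ bisimFunctional P lam d' t t' + lam * c := by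
  refine bisimFunctional_le_of_symm (b := fun t t' => bisimFunctional P lam d' t t' + lam * c)
    (fun t t' => by rw [bisimFunctional_comm]) (fun t t' ht a π hπ => ?_) t t'
  obtain ⟨π', hπ', hle⟩ :=
    isSimulated_of_bisimFunctional_lt_one (le_self_add.trans_lt ht) a π hπ
  refine ⟨π', hπ', (mul_le_mul_right (kantorovich_le_add_const h _ _) _).trans ?_⟩
  rw [mul_add]
  exact add_le_add_left hle _

theorem IsPseudometric.bisimFunctional (hd : IsPseudometric d) :
    IsPseudometric (bisimFunctional P lam d) where
  le_one := bisimFunctional_le_one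
  refl t := nonpos_iff_eq_zero.1 <|
    bisimFunctional_le (fun _ => .refl hd.refl t) fun _ => .refl hd.refl t
  symm := bisimFunctional_comm
  triangle x y z := by
    refine bisimFunctional_le (fun h => ?_) fun h => ?_
    · exact (isSimulated_of_bisimFunctional_lt_one (le_self_add.trans_lt h)).trans hd.triangle
        (isSimulated_of_bisimFunctional_lt_one (le_add_self.trans_lt h))
    · rw [add_comm, bisimFunctional_comm y, bisimFunctional_comm x] at h ⊢
      exact (isSimulated_of_bisimFunctional_lt_one (le_self_add.trans_lt h)).trans hd.triangle
        (isSimulated_of_bisimFunctional_lt_one (le_add_self.trans_lt h))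

theorem isPseudometric_sSup {X : Type u} {D : Set (X → X → ℝ≥0∞)}
    (hD : ∀ d ∈ D, IsPseudometric d) : IsPseudometric (sSup D) where
  le_one x y := by
    simp only [sSup_apply, iSup_apply]
    exact iSup_le fun d => (hD d d.2).le_one x y
  refl x := by
    simp only [sSup_apply, iSup_apply]
    exact ENNReal.iSup_eq_zero.2 fun d => (hD d d.2).refl x
  symm x y := by
    simp only [sSup_apply, iSup_apply]
    exact iSup_congr fun d => (hD d d.2).symm x y
  triangle x y z := by
    simp only [sSup_apply, iSup_apply]
    exact iSup_le fun d => ((hD d d.2).triangle x y z).trans <|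
      add_le_add (le_iSup (fun d : D => d.1 x y) d) (le_iSup (fun d : D => d.1 y z) d)

theorem isBisimulationMetric_iff :
    IsBisimulationMetric P lam d ↔ IsPseudometric d ∧ bisimFunctional P lam d ≤ d := by
  constructor
  · intro h
    exact ⟨h.isPseudometric, bisimFunctional_le_of_symm h.isPseudometric.symm h.transfer⟩
  · rintro ⟨hd, h⟩
    exact ⟨hd, fun t t' ht => ((bisimFunctional_le_iff ht).1 (h t t')).1⟩

theorem isBisimulationMetric_lfp :
    IsBisimulationMetric P lam (OrderHom.lfp ⟨bisimFunctional P lam, monotone_bisimFunctional⟩) :=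
  -- The functional acts on all functions, but it preserves pseudometrics, and these are closed
  -- under suprema: hence its least fixed point is one of them.
  isBisimulationMetric_iff.2 ⟨OrderHom.lfp_induction _ (fun _ h _ => h.bisimFunctional)
    fun _ => isPseudometric_sSup, (OrderHom.map_lfp ⟨bisimFunctional P lam, _⟩).le⟩

theorem bisimilarityMetric_eq_lfp :
    bisimilarityMetric P lam = OrderHom.lfp ⟨bisimFunctional P lam, monotone_bisimFunctional⟩ :=
  le_antisymm (sInf_le isBisimulationMetric_lfp)
    (le_sInf fun _ hd => OrderHom.lfp_le _ (isBisimulationMetric_iff.1 hd).2)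

theorem isBisimulationMetric_bisimilarityMetric :
    IsBisimulationMetric P lam (bisimilarityMetric P lam) :=
  bisimilarityMetric_eq_lfp ▸ isBisimulationMetric_lfp

theorem bisimFunctional_bisimilarityMetric :
    bisimFunctional P lam (bisimilarityMetric P lam) = bisimilarityMetric P lam := by
  rw [bisimilarityMetric_eq_lfp]
  exact OrderHom.map_lfp ⟨bisimFunctional P lam, monotone_bisimFunctional⟩

theorem isPseudometric_bisimilarityMetric : IsPseudometric (bisimilarityMetric P lam) :=
  isBisimulationMetric_bisimilarityMetric.isPseudometric

theorem upToMetric_succ (k : ℕ) :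
    upToMetric P lam (k + 1) = bisimFunctional P lam (upToMetric P lam k) :=
  Function.iterate_succ_apply' _ _ _

theorem isPseudometric_upToMetric (k : ℕ) : IsPseudometric (upToMetric P lam k) := by
  induction k with
  | zero => exact ⟨fun _ _ => zero_le, fun _ => rfl, fun _ _ => rfl, fun _ _ _ => zero_le⟩
  | succ k ih => rw [upToMetric_succ]; exact ih.bisimFunctional

theorem upToMetric_le_bisimilarityMetric (k : ℕ) :
    upToMetric P lam k ≤ bisimilarityMetric P lam := by
  induction k with
  | zero => exact fun _ _ => zero_le
  | succ k ih =>
    rw [upToMetric_succ, ← bisimFunctional_bisimilarityMetric]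
    exact monotone_bisimFunctional ih

theorem bisimilarityMetric_le_upToMetric_add_pow (k : ℕ) (t t' : Proc S) :
    bisimilarityMetric P lam t t' ≤ upToMetric P lam k t t' + (lam : ℝ≥0∞) ^ k := by
  induction k generalizing t t' with
  | zero => simpa using le_add_left (isPseudometric_bisimilarityMetric.le_one t t')
  | succ k ih =>
    rw [upToMetric_succ, ← bisimFunctional_bisimilarityMetric, pow_succ']
    exact bisimFunctional_le_add_const ih t t'

theorem isUniformlyContinuous_bisimilarityMetric (hlam : lam < 1) {f : S.Op}
    (hf : ∀ k, ∃ K, IsLipschitz (upToMetric P lam k) f K) :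
    IsUniformlyContinuous (bisimilarityMetric P lam) f := by
  intro ε hε
  rcases eq_or_ne ε ∞ with rfl | hε_top
  · exact ⟨fun _ => 1, fun _ => one_pos, fun _ _ _ =>
      (isPseudometric_bisimilarityMetric.le_one _ _).trans_lt ENNReal.one_lt_top⟩
  obtain ⟨k, hk⟩ : ∃ k : ℕ, (lam : ℝ≥0∞) ^ k < ε / 2 :=
    ((ENNReal.tendsto_pow_atTop_nhds_zero_of_lt_one (by exact_mod_cast hlam)).eventually
      (gt_mem_nhds (ENNReal.half_pos hε.ne'))).exists
  obtain ⟨K, hK⟩ := hf k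
  have modulus_pos : 0 < ε / 2 / (K * S.ar f) :=
    ENNReal.div_pos (ENNReal.half_pos hε.ne').ne'
      (ENNReal.mul_ne_top ENNReal.coe_ne_top (ENNReal.natCast_ne_top _))
  refine ⟨fun _ => ε / 2 / (K * S.ar f), fun _ => modulus_pos, fun x y hxy => ?_⟩
  have sum_le : ∑ i, upToMetric P lam k (x i) (y i) ≤ S.ar f * (ε / 2 / (K * S.ar f)) := by
    refine (Finset.sum_le_card_nsmul _ _ _ fun i _ =>
      (upToMetric_le_bisimilarityMetric k (x i) (y i)).trans (hxy i).le).trans_eq ?_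
    rw [Finset.card_univ, Fintype.card_fin, nsmul_eq_mul]
  calc bisimilarityMetric P lam (.app f x) (.app f y)
      ≤ upToMetric P lam k (.app f x) (.app f y) + lam ^ k :=
        bisimilarityMetric_le_upToMetric_add_pow k _ _
    _ ≤ K * (S.ar f * (ε / 2 / (K * S.ar f))) + lam ^ k :=
        add_le_add_left ((hK x y).trans (mul_le_mul_right sum_le _)) _
    _ ≤ ε / 2 + lam ^ k := by
        rw [← mul_assoc]
        exact add_le_add_left ENNReal.mul_div_le _
    _ < ε / 2 + ε / 2 := ENNReal.add_lt_add_left (ENNReal.div_ne_top hε_top two_ne_zero) hk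
    _ = ε := ENNReal.add_halves ε

end Bisimulation

/-! ### Operators and transitions of disjoint extensions -/

section DisjointExtension

variable {S₁ : Signature.{u}} {S₂ : Signature.{v}} {A : Type w}

/-- The process over `S₂` that applies the operator `f` of the smaller signature `S₁` to `ts`. -/
def opTerm (e : S₁.Embedding S₂) (f : S₁.Op) (ts : Fin (S₁.ar f) → Proc S₂) : Proc S₂ :=
  .app (e.toFun f) fun i => ts (Fin.cast (e.ar_eq f) i)

theorem step_opTerm_iff {e : S₁.Embedding S₂} {P₁ : PTSS S₁ A} {P₂ : PTSS S₂ A}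
    (hP : IsDisjointExtension e P₁ P₂) {f : S₁.Op} {ts : Fin (S₁.ar f) → Proc S₂} {a : A}
    {π : PMF (Proc S₂)} :
    P₂.step (opTerm e f ts) a π ↔ ∃ ru ∈ P₁.rules f a, ∃ ρ : Fin ru.numPos → PMF (Proc S₂),
      (∀ k, P₂.step (ts (ru.posArg k)) (ru.posLabel k) (ρ k)) ∧
      (∀ j, ∀ π', ¬ P₂.step (ts (ru.negArg j)) (ru.negLabel j) π') ∧
      π = (ru.target.map e (Fin.cast (e.ar_eq f).symm)).eval
        (fun i => ts (Fin.cast (e.ar_eq f) i)) ρ := by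
  change (∃ ru ∈ P₂.rules (e.toFun f) a, _) ↔ _
  rw [hP f a, Set.exists_mem_image]
  rfl

theorem prodPMF_map_cast {X : Type u} {Y : Type v} {m n : ℕ} (h : m = n) (π : Fin n → PMF X)
    (g : (Fin m → X) → Y) :
    (prodPMF m fun i => π (Fin.cast h i)).map g =
      (prodPMF n π).map fun x => g fun i => x (Fin.cast h i) := by
  subst h
  rfl

theorem prodPMF_one_map {X : Type u} {Y : Type v} (π : Fin 1 → PMF X) (g : (Fin 1 → X) → Y) :
    (prodPMF 1 π).map g = (π 0).map fun x => g ![x] := by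
  simp only [prodPMF, PMF.map_bind, PMF.pure_map]
  exact PMF.bind_pure_comp (fun x => g ![x]) (π 0)

theorem prodPMF_two_map {X : Type u} {Y : Type v} (π : Fin 2 → PMF X) (g : (Fin 2 → X) → Y) :
    (prodPMF 2 π).map g = map₂ (fun x y => g ![x, y]) (π 0) (π 1) := by
  simp only [prodPMF.eq_2 1, PMF.map_bind, PMF.map_comp, prodPMF_one_map]
  rfl

theorem eval_map_app (e : S₁.Embedding S₂) {V W D : Type} (g : V → W) (σ : W → Proc S₂)
    (ρ : D → PMF (Proc S₂)) (f : S₁.Op) (θ : Fin (S₁.ar f) → DTerm S₁ V D) :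
    ((DTerm.app f θ).map e g).eval σ ρ =
      (prodPMF (S₁.ar f) fun i => ((θ i).map e g).eval σ ρ).map (opTerm e f) :=
  prodPMF_map_cast (e.ar_eq f) (fun i => ((θ i).map e g).eval σ ρ) (Term.app (e.toFun f))

end DisjointExtension

section CpTransitions

variable {A : Type u} {S : Signature.{v}} (e : (cpSignature A).Embedding S)

/-- The stopped process `0`. -/
def nilP : Proc S := opTerm e .nil ![]

/-- Alternative composition `x + y` of processes. -/
def altP (x y : Proc S) : Proc S := opTerm e .alt ![x, y]

/-- Synchronous parallel composition `x | y` of processes. -/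
def parP (x y : Proc S) : Proc S := opTerm e .par ![x, y]

/-- The process `cp(x)`. -/
def cpP (x : Proc S) : Proc S := opTerm e .cp ![x]

variable {e} {tick l r s : A} {P : PTSS S A} {a : A} {π : PMF (Proc S)} {x y : Proc S}

theorem not_step_nilP (hP : IsDisjointExtension e (cpSpec tick l r s) P) :
    ¬ P.step (nilP e) a π := fun h =>
  let ⟨_, hru, _⟩ := (step_opTerm_iff hP).1 h
  hru

theorem step_pre_iff (hP : IsDisjointExtension e (cpSpec tick l r s) P) {b : A} {n : ℕ}
    {p : PMF (Fin n)} {hp : ∀ i, p i ≠ 0} {ts : Fin n → Proc S} :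
    P.step (opTerm e (.pre b n p hp) ts) a π ↔ a = b ∧ π = p.map ts := by
  refine (step_opTerm_iff hP).trans ⟨?_, ?_⟩
  · rintro ⟨_, ⟨rfl, rfl⟩, _, -, -, rfl⟩
    exact ⟨rfl, PMF.bind_pure_comp _ _⟩
  · rintro ⟨rfl, rfl⟩
    exact ⟨_, ⟨rfl, rfl⟩, ![], fun k => k.elim0, fun k => k.elim0, (PMF.bind_pure_comp _ _).symm⟩

theorem step_altP_iff (hP : IsDisjointExtension e (cpSpec tick l r s) P) :
    P.step (altP e x y) a π ↔ P.step x a π ∨ P.step y a π := by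
  refine (step_opTerm_iff hP).trans ⟨?_, ?_⟩
  · rintro ⟨_, rfl | rfl, _, h, -, rfl⟩
    · exact .inl (h (0 : Fin 1))
    · exact .inr (h (0 : Fin 1))
  · rintro (h | h)
    · exact ⟨_, .inl rfl, fun _ => π, fun _ => h, fun k => k.elim0, rfl⟩
    · exact ⟨_, .inr rfl, fun _ => π, fun _ => h, fun k => k.elim0, rfl⟩

theorem eval_syncRule_target (a : A) {n : ℕ} (g : Fin 2 → Fin n) (σ : Fin n → Proc S)
    (ρ : Fin 2 → PMF (Proc S)) :
    ((syncRule a).target.map e g).eval σ ρ = map₂ (parP e) (ρ 0) (ρ 1) :=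
  (eval_map_app e g σ ρ _ _).trans (prodPMF_two_map _ _)

theorem eval_terminateRule_target (tick : A) {n : ℕ} (g : Fin 2 → Fin n) (σ : Fin n → Proc S)
    (ρ : Fin 2 → PMF (Proc S)) :
    ((terminateRule tick).target.map e g).eval σ ρ = PMF.pure (nilP e) :=
  congrArg PMF.pure <| congrArg (Term.app _) <| funext fun i => (Fin.cast (e.ar_eq .nil) i).elim0

theorem eval_forkRule_target (l r : A) {n : ℕ} (g : Fin 1 → Fin n) (σ : Fin n → Proc S)
    (ρ : Fin 2 → PMF (Proc S)) :
    ((forkRule l r).target.map e g).eval σ ρ =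
      map₂ (parP e) ((ρ 0).map (cpP e)) ((ρ 1).map (cpP e)) := by
  have eval_cp (i : Fin 2) : ((DTerm.app (S := cpSignature A) CpOp.cp
      fun _ : Fin 1 => .var i).map e g).eval σ ρ = (ρ i).map (cpP e) :=
    (eval_map_app e g σ ρ _ _).trans (prodPMF_one_map _ _)
  rw [← eval_cp, ← eval_cp]
  exact (eval_map_app e g σ ρ _ _).trans (prodPMF_two_map _ _)

theorem step_parP_iff (hP : IsDisjointExtension e (cpSpec tick l r s) P) :
    P.step (parP e x y) a π ↔ ∃ μ ν, P.step x a μ ∧ P.step y a ν ∧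
      ((a ≠ tick ∧ π = map₂ (parP e) μ ν) ∨ (a = tick ∧ π = PMF.pure (nilP e))) := by
  refine (step_opTerm_iff hP).trans ⟨?_, ?_⟩
  · rintro ⟨_, ⟨ha, rfl⟩ | ⟨rfl, rfl⟩, ρ, h, -, rfl⟩
    · exact ⟨_, _, h (0 : Fin 2), h (1 : Fin 2), .inl ⟨ha, eval_syncRule_target _ _ _ _⟩⟩
    · exact ⟨_, _, h (0 : Fin 2), h (1 : Fin 2), .inr ⟨rfl, eval_terminateRule_target _ _ _ _⟩⟩
  · rintro ⟨μ, ν, hμ, hν, ⟨ha, rfl⟩ | ⟨rfl, rfl⟩⟩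
    · exact ⟨syncRule a, .inl ⟨ha, rfl⟩, ![μ, ν], Fin.forall_fin_two.2 ⟨hμ, hν⟩,
        fun k => k.elim0, (eval_syncRule_target _ _ _ ![μ, ν]).symm⟩
    · exact ⟨terminateRule a, .inr ⟨rfl, rfl⟩, ![μ, ν], Fin.forall_fin_two.2 ⟨hμ, hν⟩,
        fun k => k.elim0, (eval_terminateRule_target _ _ _ ![μ, ν]).symm⟩

theorem step_cpP_iff (hP : IsDisjointExtension e (cpSpec tick l r s) P) :
    P.step (cpP e x) a π ↔ (a ≠ l ∧ a ≠ r ∧ P.step x a π) ∨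
      (a = s ∧ ∃ μ ν, P.step x l μ ∧ P.step x r ν ∧
        π = map₂ (parP e) (μ.map (cpP e)) (ν.map (cpP e))) := by
  refine (step_opTerm_iff hP).trans ⟨?_, ?_⟩
  · rintro ⟨_, ⟨hl, hr, rfl⟩ | ⟨rfl, rfl⟩, ρ, h, -, rfl⟩
    · exact .inl ⟨hl, hr, h (0 : Fin 1)⟩
    · exact .inr ⟨rfl, _, _, h (0 : Fin 2), h (1 : Fin 2), eval_forkRule_target _ _ _ _ _⟩
  · rintro (⟨hl, hr, h⟩ | ⟨rfl, μ, ν, hμ, hν, rfl⟩)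
    · exact ⟨_, .inl ⟨hl, hr, rfl⟩, fun _ => π, fun _ => h, fun k => k.elim0, rfl⟩
    · exact ⟨forkRule l r, .inr ⟨rfl, rfl⟩, ![μ, ν], Fin.forall_fin_two.2 ⟨hμ, hν⟩,
        fun k => k.elim0, (eval_forkRule_target _ _ _ _ ![μ, ν]).symm⟩

end CpTransitions

/-! ### Parallel composition is nonexpansive, each step of copying doubles the distance -/

section Continuity

variable {A : Type u} {S : Signature.{v}} {e : (cpSignature A).Embedding S} {tick l r s : A}
  {P : PTSS S A} {lam : ℝ≥0} {d : Proc S → Proc S → ℝ≥0∞} {c c' K : ℝ≥0∞} {x x' y y' : Proc S}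

theorem isLipschitz_toFun_iff {S₁ : Signature.{u}} {e : S₁.Embedding S} {f : S₁.Op} {K : ℝ≥0} :
    IsLipschitz d (e.toFun f) K ↔
      ∀ ts ts', d (opTerm e f ts) (opTerm e f ts') ≤ K * ∑ i, d (ts i) (ts' i) := by
  constructor
  · intro h ts ts'
    exact (h _ _).trans_eq <| congrArg _ <|
      (finCongr (e.ar_eq f)).sum_comp fun i => d (ts i) (ts' i)
  · intro h ts ts'
    exact (h (fun i => ts (Fin.cast (e.ar_eq f).symm i))
      fun i => ts' (Fin.cast (e.ar_eq f).symm i)).trans_eq <| congrArg _ <|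
        (finCongr (e.ar_eq f).symm).sum_comp fun i => d (ts i) (ts' i)

theorem isLipschitz_cp_iff {K : ℝ≥0} :
    IsLipschitz d (e.toFun CpOp.cp) K ↔ ∀ x y, d (cpP e x) (cpP e y) ≤ K * d x y := by
  refine isLipschitz_toFun_iff.trans ⟨fun h x y => ?_, fun h ts ts' => ?_⟩
  · exact (h ![x] ![y]).trans_eq (congrArg _ (Fin.sum_univ_one fun i => d (![x] i) (![y] i)))
  · have eta (ts : Fin 1 → Proc S) : ts = ![ts 0] := List.ofFn_inj.1 rfl
    have sum_eq : ∑ i : Fin 1, d (ts i) (ts' i) = d (ts (0 : Fin 1)) (ts' (0 : Fin 1)) :=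
      Fin.sum_univ_one _
    rw [eta ts, eta ts']
    exact (h _ _).trans_eq (congrArg _ sum_eq.symm)

theorem isSimulated_parP (hP : IsDisjointExtension e (cpSpec tick l r s) P)
    (hd : ∀ x, d x x = 0)
    (hpar : ∀ x x' y y', d (parP e x y) (parP e x' y') ≤ d x x' + d y y')
    (hx : IsSimulated P lam d c x x') (hy : IsSimulated P lam d c' y y') :
    IsSimulated P lam d (c + c') (parP e x y) (parP e x' y') := by
  intro a π hπ
  obtain ⟨μ, ν, hμ, hν, h⟩ := (step_parP_iff hP).1 hπ
  obtain ⟨μ', hμ', hle_μ⟩ := hx a μ hμ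
  obtain ⟨ν', hν', hle_ν⟩ := hy a ν hν
  rcases h with ⟨ha, rfl⟩ | ⟨ha, rfl⟩
  · refine ⟨_, (step_parP_iff hP).2 ⟨μ', ν', hμ', hν', .inl ⟨ha, rfl⟩⟩, ?_⟩
    calc lam * kantorovich d (map₂ (parP e) μ ν) (map₂ (parP e) μ' ν')
        ≤ lam * (kantorovich d μ μ' + kantorovich d ν ν') :=
          mul_le_mul_right (kantorovich_map₂_le _ hpar _ _ _ _) _
      _ ≤ c + c' := by rw [mul_add]; exact add_le_add hle_μ hle_ν
  · refine ⟨_, (step_parP_iff hP).2 ⟨μ', ν', hμ', hν', .inr ⟨ha, rfl⟩⟩, ?_⟩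
    rw [kantorovich_self hd, mul_zero]
    exact zero_le

theorem bisimFunctional_parP_le (hP : IsDisjointExtension e (cpSpec tick l r s) P)
    (hd : ∀ x, d x x = 0)
    (hpar : ∀ x x' y y', d (parP e x y) (parP e x' y') ≤ d x x' + d y y') (x x' y y' : Proc S) :
    bisimFunctional P lam d (parP e x y) (parP e x' y') ≤
      bisimFunctional P lam d x x' + bisimFunctional P lam d y y' := by
  refine bisimFunctional_le (fun h => ?_) fun h => ?_
  · exact isSimulated_parP hP hd hpar
      (isSimulated_of_bisimFunctional_lt_one (le_self_add.trans_lt h))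
      (isSimulated_of_bisimFunctional_lt_one (le_add_self.trans_lt h))
  · rw [bisimFunctional_comm x, bisimFunctional_comm y] at h ⊢
    exact isSimulated_parP hP hd hpar
      (isSimulated_of_bisimFunctional_lt_one (le_self_add.trans_lt h))
      (isSimulated_of_bisimFunctional_lt_one (le_add_self.trans_lt h))

theorem upToMetric_parP_le (hP : IsDisjointExtension e (cpSpec tick l r s) P) (k : ℕ)
    (x x' y y' : Proc S) :
    upToMetric P lam k (parP e x y) (parP e x' y') ≤
      upToMetric P lam k x x' + upToMetric P lam k y y' := by
  induction k generalizing x x' y y' with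
  | zero => exact zero_le
  | succ k ih =>
    rw [upToMetric_succ]
    exact bisimFunctional_parP_le hP (isPseudometric_upToMetric k).refl ih x x' y y'

theorem isSimulated_cpP (hP : IsDisjointExtension e (cpSpec tick l r s) P)
    (hpar : ∀ x x' y y', d (parP e x y) (parP e x' y') ≤ d x x' + d y y')
    (hK : 1 ≤ K) (hK_top : K ≠ ∞) (hcp : ∀ x x', d (cpP e x) (cpP e x') ≤ K * d x x')
    (hx : IsSimulated P lam d c x x') :
    IsSimulated P lam d (2 * K * c) (cpP e x) (cpP e x') := by
  intro a π hπ
  rcases (step_cpP_iff hP).1 hπ with ⟨hl, hr, hπ⟩ | ⟨ha, μ, ν, hμ, hν, rfl⟩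
  · obtain ⟨π', hπ', hle⟩ := hx a π hπ
    refine ⟨π', (step_cpP_iff hP).2 (.inl ⟨hl, hr, hπ'⟩), hle.trans ?_⟩
    exact le_mul_of_one_le_left zero_le (one_le_mul one_le_two hK)
  · obtain ⟨μ', hμ', hle_μ⟩ := hx l μ hμ
    obtain ⟨ν', hν', hle_ν⟩ := hx r ν hν
    refine ⟨_, (step_cpP_iff hP).2 (.inr ⟨ha, μ', ν', hμ', hν', rfl⟩), ?_⟩
    have kantorovich_cp_le := kantorovich_map_le (zero_lt_one.trans_le hK).ne' hK_top _ hcp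
    calc (lam : ℝ≥0∞) * kantorovich d
          (map₂ (parP e) (μ.map (cpP e)) (ν.map (cpP e)))
          (map₂ (parP e) (μ'.map (cpP e)) (ν'.map (cpP e)))
        ≤ lam * (K * kantorovich d μ μ' + K * kantorovich d ν ν') :=
          mul_le_mul_right ((kantorovich_map₂_le _ hpar _ _ _ _).trans
            (add_le_add (kantorovich_cp_le μ μ') (kantorovich_cp_le ν ν'))) _
      _ = K * (lam * kantorovich d μ μ' + lam * kantorovich d ν ν') := by ring
      _ ≤ K * (c + c) := mul_le_mul_right (add_le_add hle_μ hle_ν) _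
      _ = 2 * K * c := by ring

theorem bisimFunctional_cpP_le (hP : IsDisjointExtension e (cpSpec tick l r s) P)
    (hpar : ∀ x x' y y', d (parP e x y) (parP e x' y') ≤ d x x' + d y y')
    (hK : 1 ≤ K) (hK_top : K ≠ ∞) (hcp : ∀ x x', d (cpP e x) (cpP e x') ≤ K * d x x')
    (x x' : Proc S) :
    bisimFunctional P lam d (cpP e x) (cpP e x') ≤ 2 * K * bisimFunctional P lam d x x' := by
  have self_le (b : ℝ≥0∞) : b ≤ 2 * K * b :=
    le_mul_of_one_le_left zero_le (one_le_mul one_le_two hK)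
  refine bisimFunctional_le (fun h => ?_) fun h => ?_
  · exact isSimulated_cpP hP hpar hK hK_top hcp
      (isSimulated_of_bisimFunctional_lt_one ((self_le _).trans_lt h))
  · rw [bisimFunctional_comm x] at h ⊢
    exact isSimulated_cpP hP hpar hK hK_top hcp
      (isSimulated_of_bisimFunctional_lt_one ((self_le _).trans_lt h))

theorem upToMetric_cpP_le (hP : IsDisjointExtension e (cpSpec tick l r s) P) (k : ℕ)
    (x x' : Proc S) :
    upToMetric P lam k (cpP e x) (cpP e x') ≤ 2 ^ k * upToMetric P lam k x x' := by
  induction k generalizing x x' with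
  | zero => exact zero_le
  | succ k ih =>
    rw [upToMetric_succ, pow_succ']
    exact bisimFunctional_cpP_le hP (upToMetric_parP_le hP k) (one_le_pow_of_one_le' one_le_two k)
      (ENNReal.pow_ne_top ENNReal.ofNat_ne_top) ih x x'

theorem isLipschitz_upToMetric_cp (hP : IsDisjointExtension e (cpSpec tick l r s) P) (k : ℕ) :
    IsLipschitz (upToMetric P lam k) (e.toFun CpOp.cp) (2 ^ k) :=
  isLipschitz_cp_iff.2 fun x y => by simpa using upToMetric_cpP_le hP k x y

end Continuity

/-! ### Amplification of small differences by copying -/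

section Enabled

variable {S : Signature.{u}} {A : Type v} {P : PTSS S A} {lam : ℝ≥0}
  {d : Proc S → Proc S → ℝ≥0∞} {a : A} {t t' : Proc S} {π π' : PMF (Proc S)}

theorem IsBisimulationMetric.mul_kantorovich_le (hd : IsBisimulationMetric P lam d)
    (h : d t t' < 1) (ht : P.der t a = {π}) (ht' : P.der t' a = {π'}) :
    lam * kantorovich d π π' ≤ d t t' := by
  obtain ⟨_, hπ', hle⟩ := hd.transfer t t' h a π (ht.symm.subset rfl)
  rwa [← ht'.subset hπ']

open Classical in
/-- The indicator function of the processes that have an `a`-labelled transition. -/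
noncomputable def enabled (P : PTSS S A) (a : A) (t : Proc S) : ℝ≥0∞ :=
  if (P.der t a).Nonempty then 1 else 0

theorem IsBisimulationMetric.enabled_le (hd : IsBisimulationMetric P lam d) (t t' : Proc S) :
    enabled P a t ≤ enabled P a t' + d t t' := by
  by_cases ht : (P.der t a).Nonempty
  · rw [enabled, if_pos ht]
    rcases lt_or_ge (d t t') 1 with h | h
    · obtain ⟨π, hπ⟩ := ht
      obtain ⟨π', hπ', -⟩ := hd.transfer t t' h a π hπ
      rw [enabled, if_pos ⟨π', hπ'⟩]
      exact le_self_add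
    · exact le_add_left h
  · rw [enabled, if_neg ht]
    exact zero_le

end Enabled

section Duplication

variable {A : Type u} {S : Signature.{v}} (e : (cpSignature A).Embedding S)

/-- The parallel composition of two copies of a process. -/
def dupP (x : Proc S) : Proc S := parP e x x

/-- The parallel composition of two independent copies of a random process. -/
noncomputable def dupPMF (μ : PMF (Proc S)) : PMF (Proc S) := map₂ (parP e) μ μ

theorem iterate_dupPMF_pure (k : ℕ) (x : Proc S) :
    (dupPMF e)^[k] (PMF.pure x) = PMF.pure ((dupP e)^[k] x) :=
  have dupPMF_pure : Function.Semiconj PMF.pure (dupP e) (dupPMF e) := fun x => by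
    simp only [dupPMF, map₂, PMF.pure_bind, PMF.pure_map, dupP]
  ((dupPMF_pure.iterate_right k) x).symm

variable {e} {tick l r s : A} {P : PTSS S A} {a : A} {x y : Proc S} {μ ν : PMF (Proc S)}

theorem der_parP (hP : IsDisjointExtension e (cpSpec tick l r s) P) (ha : a ≠ tick)
    (hx : P.der x a = {μ}) (hy : P.der y a = {ν}) :
    P.der (parP e x y) a = {map₂ (parP e) μ ν} := by
  have step_x (π) : P.step x a π ↔ π = μ := Set.ext_iff.1 hx π
  have step_y (π) : P.step y a π ↔ π = ν := Set.ext_iff.1 hy π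
  ext π
  refine (step_parP_iff hP).trans ?_
  simp only [step_x, step_y, ha, ne_eq, not_false_eq_true, true_and, false_and, or_false,
    exists_and_left, exists_eq_left, Set.mem_singleton_iff]

theorem der_iterate_dupP (hP : IsDisjointExtension e (cpSpec tick l r s) P) (ha : a ≠ tick)
    (hx : P.der x a = {μ}) (k : ℕ) : P.der ((dupP e)^[k] x) a = {(dupPMF e)^[k] μ} := by
  induction k with
  | zero => exact hx
  | succ k ih =>
    rw [Function.iterate_succ_apply', Function.iterate_succ_apply']
    exact der_parP hP ha ih ih

theorem enabled_parP (hP : IsDisjointExtension e (cpSpec tick l r s) P) (a : A) (x y : Proc S) :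
    enabled P a (parP e x y) = enabled P a x * enabled P a y := by
  have der_nonempty : (P.der (parP e x y) a).Nonempty ↔
      (P.der x a).Nonempty ∧ (P.der y a).Nonempty := by
    refine ⟨fun ⟨π, hπ⟩ => ?_, fun ⟨⟨μ, hμ⟩, ν, hν⟩ => ?_⟩
    · obtain ⟨μ, ν, hμ, hν, -⟩ := (step_parP_iff hP).1 hπ
      exact ⟨⟨μ, hμ⟩, ν, hν⟩
    · by_cases ha : a = tick
      · exact ⟨_, (step_parP_iff hP).2 ⟨μ, ν, hμ, hν, .inr ⟨ha, rfl⟩⟩⟩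
      · exact ⟨_, (step_parP_iff hP).2 ⟨μ, ν, hμ, hν, .inl ⟨ha, rfl⟩⟩⟩
  classical
  simp only [enabled, der_nonempty, ite_zero_mul_ite_zero, mul_one]

theorem expect_iterate_dupPMF_enabled (hP : IsDisjointExtension e (cpSpec tick l r s) P) (a : A)
    (μ : PMF (Proc S)) (k : ℕ) :
    expect ((dupPMF e)^[k] μ) (enabled P a) = expect μ (enabled P a) ^ 2 ^ k := by
  induction k with
  | zero => exact (pow_one _).symm
  | succ k ih =>
    rw [Function.iterate_succ_apply', dupPMF, expect_map₂]
    simp only [enabled_parP hP, expect_const_mul, expect_mul_const, ih]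
    rw [← sq, ← pow_mul, ← pow_succ]

end Duplication

section Fork

variable {A : Type u} {S : Signature.{v}} (e : (cpSignature A).Embedding S) (l r : A)

/-- The process `l.⊕ᵢ[pᵢ]tsᵢ + r.⊕ᵢ[pᵢ]tsᵢ`, which `cp` turns into two independent copies. -/
def forkP {n : ℕ} (p : PMF (Fin n)) (hp : ∀ i, p i ≠ 0) (ts : Fin n → Proc S) : Proc S :=
  altP e (opTerm e (.pre l n p hp) ts) (opTerm e (.pre r n p hp) ts)

/-- The process `l.x + r.x`. -/
noncomputable def forkDirac (x : Proc S) : Proc S :=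
  forkP e l r (PMF.pure (0 : Fin 1))
    (fun i => by rw [Subsingleton.elim i 0, PMF.pure_apply_self]; exact one_ne_zero) fun _ => x

variable {e l r} {tick s a : A} {P : PTSS S A} {lam : ℝ≥0} {d : Proc S → Proc S → ℝ≥0∞}
  {π : PMF (Proc S)} {n : ℕ} {p : PMF (Fin n)} {hp : ∀ i, p i ≠ 0}

theorem step_forkP_iff (hP : IsDisjointExtension e (cpSpec tick l r s) P) {ts : Fin n → Proc S} :
    P.step (forkP e l r p hp ts) a π ↔ (a = l ∨ a = r) ∧ π = p.map ts := by
  rw [forkP, step_altP_iff hP, step_pre_iff hP, step_pre_iff hP, or_and_right]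

theorem der_cpP_forkP (hP : IsDisjointExtension e (cpSpec tick l r s) P) (ts : Fin n → Proc S) :
    P.der (cpP e (forkP e l r p hp ts)) s = {dupPMF e (p.map (cpP e ∘ ts))} := by
  ext π
  refine (step_cpP_iff hP).trans ?_
  rw [Set.mem_singleton_iff, dupPMF, ← PMF.map_comp]
  constructor
  · rintro (⟨hl, hr, h⟩ | ⟨-, μ, ν, hμ, hν, rfl⟩)
    · exact (not_or.2 ⟨hl, hr⟩ ((step_forkP_iff hP).1 h).1).elim
    · rw [((step_forkP_iff hP).1 hμ).2, ((step_forkP_iff hP).1 hν).2]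
  · rintro rfl
    exact .inr ⟨rfl, _, _, (step_forkP_iff hP).2 ⟨.inl rfl, rfl⟩,
      (step_forkP_iff hP).2 ⟨.inr rfl, rfl⟩, rfl⟩

theorem der_cpP_forkDirac (hP : IsDisjointExtension e (cpSpec tick l r s) P) (x : Proc S) :
    P.der (cpP e (forkDirac e l r x)) s = {PMF.pure (dupP e (cpP e x))} := by
  rw [forkDirac, der_cpP_forkP hP, PMF.pure_map]
  exact congrArg _ (iterate_dupPMF_pure e 1 (cpP e x))

theorem isSimulated_forkP (hP : IsDisjointExtension e (cpSpec tick l r s) P)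
    (ts ts' : Fin n → Proc S) :
    IsSimulated P lam d (lam * expect p fun i => d (ts i) (ts' i))
      (forkP e l r p hp ts) (forkP e l r p hp ts') := by
  intro a π hπ
  obtain ⟨ha, rfl⟩ := (step_forkP_iff hP).1 hπ
  exact ⟨_, (step_forkP_iff hP).2 ⟨ha, rfl⟩,
    mul_le_mul_right (kantorovich_map_map_le_expect d p ts ts') _⟩

theorem bisimilarityMetric_forkP_le (hP : IsDisjointExtension e (cpSpec tick l r s) P)
    (ts ts' : Fin n → Proc S) :
    bisimilarityMetric P lam (forkP e l r p hp ts) (forkP e l r p hp ts') ≤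
      lam * expect p fun i => bisimilarityMetric P lam (ts i) (ts' i) := by
  conv_lhs => rw [← bisimFunctional_bisimilarityMetric]
  refine bisimFunctional_le (fun _ => isSimulated_forkP hP ts ts') fun _ => ?_
  simp only [isPseudometric_bisimilarityMetric.symm (ts _)]
  exact isSimulated_forkP hP ts' ts

theorem bisimilarityMetric_iterate_forkDirac_le
    (hP : IsDisjointExtension e (cpSpec tick l r s) P) (n : ℕ) (x y : Proc S) :
    bisimilarityMetric P lam ((forkDirac e l r)^[n] x) ((forkDirac e l r)^[n] y) ≤
      lam ^ n * bisimilarityMetric P lam x y := by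
  induction n with
  | zero => simp
  | succ n ih =>
    rw [Function.iterate_succ_apply', Function.iterate_succ_apply', pow_succ', mul_assoc]
    refine (bisimilarityMetric_forkP_le hP _ _).trans ?_
    rw [expect_const]
    exact mul_le_mul_right ih _

theorem mul_bisimilarityMetric_iterate_dupP_le
    (hP : IsDisjointExtension e (cpSpec tick l r s) P) (hs : s ≠ tick) (k : ℕ) {x y : Proc S}
    (h : bisimilarityMetric P lam ((dupP e)^[k] (cpP e (forkDirac e l r x)))
      ((dupP e)^[k] (cpP e (forkDirac e l r y))) < 1) :
    lam * bisimilarityMetric P lam ((dupP e)^[k + 1] (cpP e x)) ((dupP e)^[k + 1] (cpP e y)) ≤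
      bisimilarityMetric P lam ((dupP e)^[k] (cpP e (forkDirac e l r x)))
        ((dupP e)^[k] (cpP e (forkDirac e l r y))) := by
  have der_eq (z : Proc S) : P.der ((dupP e)^[k] (cpP e (forkDirac e l r z))) s =
      {PMF.pure ((dupP e)^[k + 1] (cpP e z))} := by
    rw [der_iterate_dupP hP hs (der_cpP_forkDirac hP z), iterate_dupPMF_pure]
    rfl
  exact (mul_le_mul_right (isPseudometric_bisimilarityMetric.le_kantorovich_pure _ _) _).trans
    (isBisimulationMetric_bisimilarityMetric.mul_kantorovich_le h (der_eq x) (der_eq y))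

theorem bisimilarityMetric_iterate_dupP_cpP_le
    (hP : IsDisjointExtension e (cpSpec tick l r s) P) (hs : s ≠ tick) (hlam : lam ≠ 0)
    {c : ℝ≥0∞} {x y : Proc S} (k n : ℕ) (hc : ∀ j ≤ n, (lam : ℝ≥0∞) ^ j * c < 1)
    (h : bisimilarityMetric P lam ((dupP e)^[k] (cpP e ((forkDirac e l r)^[n] x)))
      ((dupP e)^[k] (cpP e ((forkDirac e l r)^[n] y))) ≤ lam ^ n * c) :
    bisimilarityMetric P lam ((dupP e)^[k + n] (cpP e x)) ((dupP e)^[k + n] (cpP e y)) ≤ c := by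
  induction n generalizing k with
  | zero => simpa using h
  | succ n ih =>
    rw [Function.iterate_succ_apply', Function.iterate_succ_apply'] at h
    have descend := (mul_bisimilarityMetric_iterate_dupP_le hP hs k
      (h.trans_lt (hc (n + 1) le_rfl))).trans h
    rw [pow_succ', mul_assoc, ENNReal.mul_le_mul_iff_right (by simpa using hlam)
      ENNReal.coe_ne_top] at descend
    rw [← Nat.succ_add_eq_add_succ]
    exact ih (k + 1) (fun j hj => hc j (hj.trans n.le_succ)) descend

theorem enabled_cpP_forkP (hP : IsDisjointExtension e (cpSpec tick l r s) P)
    (ts : Fin n → Proc S) : enabled P s (cpP e (forkP e l r p hp ts)) = 1 :=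
  if_pos (by rw [der_cpP_forkP hP]; exact Set.singleton_nonempty _)

theorem enabled_cpP_nilP (hP : IsDisjointExtension e (cpSpec tick l r s) P) (a : A) :
    enabled P a (cpP e (nilP e)) = 0 :=
  if_neg fun ⟨_, hπ⟩ => ((step_cpP_iff hP).1 hπ).elim (fun h => not_step_nilP hP h.2.2)
    fun ⟨_, _, _, hμ, _⟩ => not_step_nilP hP hμ

end Fork

section NotLipschitz

variable {A : Type u} {S : Signature.{v}} {e : (cpSignature A).Embedding S} {tick l r s : A}
  {P : PTSS S A} {lam K : ℝ≥0}

theorem expect_fin_two (p : PMF (Fin 2)) (f : Fin 2 → ℝ≥0∞) :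
    expect p f = f 0 * p 0 + f 1 * p 1 := by
  rw [expect, tsum_fintype, Fin.sum_univ_two]

theorem exists_pmf_fin_two {q : ℝ≥0∞} (hq : q ≤ 1) :
    ∃ p : PMF (Fin 2), p 0 = 1 - q ∧ p 1 = q :=
  ⟨PMF.ofFintype ![1 - q, q] (by simp [tsub_add_cancel_of_le hq]), rfl, rfl⟩

theorem kantorovich_iterate_dupPMF_le_of_isLipschitz_cp
    (hP : IsDisjointExtension e (cpSpec tick l r s) P) (hs : s ≠ tick) (hlam : lam ≠ 0)
    (hK : IsLipschitz (bisimilarityMetric P lam) (e.toFun CpOp.cp) K) {m : ℕ} {p : PMF (Fin m)}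
    (hp : ∀ i, p i ≠ 0) {ts ts' : Fin m → Proc S} {c : ℝ≥0∞}
    (hts : (expect p fun i => bisimilarityMetric P lam (ts i) (ts' i)) ≤ c) (n : ℕ)
    (hn : ∀ j ≤ n, (lam : ℝ≥0∞) ^ j * (lam * (K * c)) < 1) :
    kantorovich (bisimilarityMetric P lam) ((dupPMF e)^[n + 1] (p.map (cpP e ∘ ts)))
      ((dupPMF e)^[n + 1] (p.map (cpP e ∘ ts'))) ≤ K * c := by
  let x := forkP e l r p hp ts
  let y := forkP e l r p hp ts'
  have dist_xy : bisimilarityMetric P lam x y ≤ lam * c :=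
    (bisimilarityMetric_forkP_le hP ts ts').trans (mul_le_mul_right hts _)
  have dist_cp : bisimilarityMetric P lam (cpP e ((forkDirac e l r)^[n] x))
      (cpP e ((forkDirac e l r)^[n] y)) ≤ lam ^ n * (lam * (K * c)) :=
    calc _ ≤ K * (lam ^ n * bisimilarityMetric P lam x y) := (isLipschitz_cp_iff.1 hK _ _).trans
          (mul_le_mul_right (bisimilarityMetric_iterate_forkDirac_le hP n x y) _)
      _ ≤ K * (lam ^ n * (lam * c)) := by gcongr
      _ = _ := by ring
  have dist_dup : bisimilarityMetric P lam ((dupP e)^[n] (cpP e x)) ((dupP e)^[n] (cpP e y)) ≤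
      lam * (K * c) := by
    simpa only [zero_add] using bisimilarityMetric_iterate_dupP_cpP_le hP hs hlam 0 n hn dist_cp
  rw [← ENNReal.mul_le_mul_iff_right (ENNReal.coe_ne_zero.2 hlam) ENNReal.coe_ne_top]
  refine (isBisimulationMetric_bisimilarityMetric.mul_kantorovich_le ?_
    (der_iterate_dupP hP hs (der_cpP_forkP hP ts) n)
    (der_iterate_dupP hP hs (der_cpP_forkP hP ts') n)).trans dist_dup
  exact dist_dup.trans_lt (by simpa using hn 0 n.zero_le)

theorem one_le_pow_add_mul_of_isLipschitz_cp
    (hP : IsDisjointExtension e (cpSpec tick l r s) P) (hs : s ≠ tick) (hlam : lam ≠ 0)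
    (hK : IsLipschitz (bisimilarityMetric P lam) (e.toFun CpOp.cp) K) {q : ℝ≥0∞} (hq₀ : q ≠ 0)
    (hq₁ : q < 1) (n : ℕ) (hn : ∀ j ≤ n, (lam : ℝ≥0∞) ^ j * (lam * (K * q)) < 1) :
    1 ≤ (1 - q) ^ 2 ^ (n + 1) + K * q := by
  obtain ⟨p, hp_zero, hp_one⟩ := exists_pmf_fin_two hq₁.le
  have hp : ∀ i, p i ≠ 0 := Fin.forall_fin_two.2
    ⟨hp_zero.trans_ne (tsub_pos_of_lt hq₁).ne', hp_one.trans_ne hq₀⟩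
  let u := forkDirac e l r (nilP e)
  let μ (ts : Fin 2 → Proc S) : PMF (Proc S) := (dupPMF e)^[n + 1] (p.map (cpP e ∘ ts))
  have dist_le : (expect p fun i => bisimilarityMetric P lam (![u, u] i) (![u, nilP e] i)) ≤ q := by
    simpa [expect_fin_two, hp_one, isPseudometric_bisimilarityMetric.refl] using
      mul_le_mul_left (isPseudometric_bisimilarityMetric.le_one u (nilP e)) q
  have enabled_u : enabled P s (cpP e u) = 1 := enabled_cpP_forkP hP _
  have enabled_μ_left : expect (μ ![u, u]) (enabled P s) = 1 := by
    rw [expect_iterate_dupPMF_enabled hP, expect_map, expect_fin_two]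
    simp [enabled_u, hp_zero, hp_one, tsub_add_cancel_of_le hq₁.le]
  have enabled_μ_right : expect (μ ![u, nilP e]) (enabled P s) = (1 - q) ^ 2 ^ (n + 1) := by
    rw [expect_iterate_dupPMF_enabled hP, expect_map, expect_fin_two]
    simp [enabled_u, hp_zero, enabled_cpP_nilP hP]
  calc 1 = expect (μ ![u, u]) (enabled P s) := enabled_μ_left.symm
    _ ≤ expect (μ ![u, nilP e]) (enabled P s) +
        kantorovich (bisimilarityMetric P lam) (μ ![u, u]) (μ ![u, nilP e]) :=
      expect_le_expect_add_kantorovich isBisimulationMetric_bisimilarityMetric.enabled_le _ _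
    _ ≤ (1 - q) ^ 2 ^ (n + 1) + K * q := add_le_add enabled_μ_right.le
      (kantorovich_iterate_dupPMF_le_of_isLipschitz_cp hP hs hlam hK hp dist_le n hn)

theorem one_sub_pow_add_mul_lt_one {N : ℕ} {K q : ℝ} (hN : 2 * K < N) (hK : 0 ≤ K)
    (hq : 0 < q) (hq₁ : q ≤ 1) (hNq : N * q ≤ 1) : (1 - q) ^ N + K * q < 1 := by
  have pow_le : (1 - q) ^ N * (1 + N * q) ≤ 1 :=
    calc (1 - q) ^ N * (1 + N * q) ≤ (1 - q) ^ N * (1 + q) ^ N :=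
          mul_le_mul_of_nonneg_left (one_add_mul_le_pow (by linarith) N)
            (pow_nonneg (sub_nonneg.2 hq₁) N)
      _ = (1 - q ^ 2) ^ N := by rw [← mul_pow]; ring
      _ ≤ 1 := pow_le_one₀ (by nlinarith) (by nlinarith)
  have lt_mul : 1 < (1 - K * q) * (1 + N * q) := by
    nlinarith [mul_pos hq (sub_pos.2 hN), mul_nonneg (mul_nonneg hK hq.le) (sub_nonneg.2 hNq)]
  linarith [lt_of_mul_lt_mul_right (pow_le.trans_lt lt_mul) (by positivity)]

theorem not_isLipschitz_bisimilarityMetric_cp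
    (hP : IsDisjointExtension e (cpSpec tick l r s) P) (hs : s ≠ tick) (hlam : lam ≠ 0) :
    ¬ IsLipschitz (bisimilarityMetric P lam) (e.toFun CpOp.cp) K := by
  intro hK
  obtain ⟨n, hn⟩ : ∃ n : ℕ, 2 * K < 2 ^ (n + 1) :=
    (pow_unbounded_of_one_lt K one_lt_two).imp fun n hn => by
      rw [pow_succ']; exact mul_lt_mul_of_pos_left hn two_pos
  obtain ⟨q, hq₀, hq₁, hNq, hlam_q⟩ : ∃ q : ℝ≥0, 0 < q ∧ q < 1 ∧ 2 ^ (n + 1) * q < 1 ∧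
      (1 + lam) ^ (n + 1) * K * q < 1 := by
    let b : ℝ≥0 := 1 + 2 ^ (n + 1) + (1 + lam) ^ (n + 1) * K
    have mul_inv_lt {a : ℝ≥0} (ha : a ≤ b) : a * (b + 1)⁻¹ < 1 := by
      rw [← div_eq_mul_inv, div_lt_one (by positivity)]
      exact ha.trans_lt (lt_add_one b)
    refine ⟨(b + 1)⁻¹, by positivity, ?_, mul_inv_lt ?_, mul_inv_lt le_add_self⟩
    · exact (one_mul _).symm.trans_lt (mul_inv_lt (le_add_right le_self_add))
    · exact le_add_right le_add_self
  have pow_mul_lt (j : ℕ) (hj : j ≤ n) : lam ^ j * (lam * (K * q)) < 1 :=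
    calc lam ^ j * (lam * (K * q)) = lam ^ (j + 1) * K * q := by ring
      _ ≤ (1 + lam) ^ (n + 1) * K * q := by
        gcongr ?_ * _ * _
        exact (pow_le_pow_left₀ zero_le le_add_self _).trans
          (pow_le_pow_right₀ le_self_add (by omega))
      _ < 1 := hlam_q
  have one_le : 1 ≤ (1 - q) ^ 2 ^ (n + 1) + K * q := by
    exact_mod_cast one_le_pow_add_mul_of_isLipschitz_cp hP hs hlam hK (q := q)
      (by exact_mod_cast hq₀.ne') (by exact_mod_cast hq₁) n
      fun j hj => by exact_mod_cast pow_mul_lt j hj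
  rw [← NNReal.coe_le_coe] at one_le
  push_cast [NNReal.coe_sub hq₁.le] at one_le
  exact one_le.not_gt <| one_sub_pow_add_mul_lt_one (by exact_mod_cast hn) K.coe_nonneg hq₀ hq₁.le
    (by exact_mod_cast hNq.le)

end NotLipschitz

end PGSOS

theorem mainTheorem11_general {A : Type u} (tick l r s : A) {S : PGSOS.Signature.{v}}
    (P : PGSOS.PTSS S A) (e : (PGSOS.cpSignature A).Embedding S)
    (hP : PGSOS.IsDisjointExtension e (PGSOS.cpSpec tick l r s) P) :
    (∀ lam : ℝ≥0, lam < 1 →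
      PGSOS.IsUniformlyContinuous (PGSOS.bisimilarityMetric P lam) (e.toFun PGSOS.CpOp.cp)) ∧
    (∀ (lam : ℝ≥0) (k : ℕ),
      PGSOS.IsLipschitz (PGSOS.upToMetric P lam k) (e.toFun PGSOS.CpOp.cp) (2 ^ k)) ∧
    (s ≠ tick → ∀ lam : ℝ≥0, 0 < lam →
      ¬ ∃ K : ℝ≥0,
        PGSOS.IsLipschitz (PGSOS.bisimilarityMetric P lam) (e.toFun PGSOS.CpOp.cp) K) :=
  ⟨fun _ hlam => PGSOS.isUniformlyContinuous_bisimilarityMetric hlam fun k =>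
      ⟨2 ^ k, PGSOS.isLipschitz_upToMetric_cp hP k⟩,
    fun _ k => PGSOS.isLipschitz_upToMetric_cp hP k,
    fun hs _ hlam ⟨_, hK⟩ =>
      PGSOS.not_isLipschitz_bisimilarityMetric_cp hP hs hlam.ne' hK⟩

theorem mainTheorem11 {A : Type u} (tick l r s : A) {S : PGSOS.Signature.{v}}
    (P : PGSOS.PTSS S A) (e : (PGSOS.cpSignature A).Embedding S)
    (hP : PGSOS.IsDisjointExtension e (PGSOS.cpSpec tick l r s) P) :
    (∀ lam : ℝ≥0, 0 < lam → lam < 1 →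
      PGSOS.IsUniformlyContinuous (PGSOS.bisimilarityMetric P lam) (e.toFun PGSOS.CpOp.cp)) ∧
    (∀ lam : ℝ≥0, 0 < lam → lam ≤ 1 → ∀ k : ℕ,
      PGSOS.IsLipschitz (PGSOS.upToMetric P lam k) (e.toFun PGSOS.CpOp.cp) (2 ^ k)) ∧
    (s ≠ tick → ∀ lam : ℝ≥0, 0 < lam → lam ≤ 1 →
      ¬ ∃ K : ℝ≥0,
        PGSOS.IsLipschitz (PGSOS.bisimilarityMetric P lam) (e.toFun PGSOS.CpOp.cp) K) :=
  have ⟨uniform, lipschitz, not_lipschitz⟩ := mainTheorem11_general tick l r s P e hP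
  ⟨fun lam _ => uniform lam, fun lam _ _ => lipschitz lam,
    fun hs lam hlam _ => not_lipschitz hs lam hlam⟩
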